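/- Let $X=\{\emptyset,1,2,3,4,5,12,23,34,41\}$ be the simplicial complex with vertex set $\{1,2,3,4,5\}$, that is, the disjoint union of a point (the vertex $5$) and a square (the $4$-cycle $1,2,3,4$). The join $K*L$ of two simplicial complexes is the complex whose simplices are the disjoint unions $\sigma\sqcup\tau$ of a simplex $\sigma$ of $K$ and a simplex $\tau$ of $L$ (empty simplices allowed). For an integer $n\ge 0$ let $*_nX$ be the join of $n$ copies of $X$ (for $n=0$ this is the complex $\{\emptyset\}$). Let $\widetilde H_i$ denote reduced simplicial homology with integer coefficients, computed from the augmented chain complex in which the empty simplex spans degree $-1$. Then for every $n \ge 0$ and every integer $i$, $$\widetilde H_i(*_nX)\cong \mathbb Z^{\binom{n}{i-n+1}}\quad\text{if } n-1\le i\le 2n-1,$$ and $\widetilde H_i(*_nX)=0$ otherwise. -/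

import Mathlib

open CategoryTheory

universe u

section Chains

variable {V : Type u} [LinearOrder V]

/-- The boundary map on formal integer combinations of finite subsets of an ordered vertex set:
`∂ {v₀ < ⋯ < vₖ} = ∑ⱼ (-1)ʲ {v₀, …, vⱼ₋₁, vⱼ₊₁, …, vₖ}`, where `j` is the number of vertices of the
set that are smaller than `vⱼ`. In particular `∂ {v} = ∅` (the augmentation) and `∂ ∅ = 0`. -/
noncomputable def simplexBoundary (V : Type u) [LinearOrder V] :
    (Finset V →₀ ℤ) →ₗ[ℤ] (Finset V →₀ ℤ) :=
  Finsupp.linearCombination ℤ fun s : Finset V =>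
    ∑ v ∈ s, Finsupp.single (s.erase v) ((-1 : ℤ) ^ (s.filter (· < v)).card)

lemma simplexBoundary_single (s : Finset V) :
    simplexBoundary V (Finsupp.single s 1) =
      ∑ v ∈ s, Finsupp.single (s.erase v) ((-1 : ℤ) ^ (s.filter (· < v)).card) := by
  simp [simplexBoundary]

lemma simplexBoundary_sign (s : Finset V) {v w : V} (hv : v ∈ s) (h : v < w) :
    (-1 : ℤ) ^ (s.filter (· < v)).card * (-1) ^ ((s.erase v).filter (· < w)).card
      + (-1) ^ (s.filter (· < w)).card * (-1) ^ ((s.erase w).filter (· < v)).card = 0 := by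
  have h1 : (s.erase w).filter (· < v) = s.filter (· < v) := by
    ext x
    simp only [Finset.mem_filter, Finset.mem_erase]
    constructor
    · rintro ⟨⟨_, hx⟩, hxv⟩
      exact ⟨hx, hxv⟩
    · rintro ⟨hx, hxv⟩
      exact ⟨⟨(hxv.trans h).ne, hx⟩, hxv⟩
  have h2 : (s.erase v).filter (· < w) = (s.filter (· < w)).erase v := by
    ext x
    simp only [Finset.mem_filter, Finset.mem_erase]
    tauto
  have h3 : ((s.filter (· < w)).erase v).card + 1 = (s.filter (· < w)).card :=
    Finset.card_erase_add_one (Finset.mem_filter.mpr ⟨hv, h⟩)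
  rw [h1, h2, ← h3, pow_succ]
  ring

lemma simplexBoundary_comp_self : simplexBoundary V ∘ₗ simplexBoundary V = 0 := by
  refine Finsupp.lhom_ext' fun s => LinearMap.ext_ring ?_
  simp only [LinearMap.comp_apply, Finsupp.lsingle_apply, LinearMap.zero_apply]
  rw [simplexBoundary_single, map_sum]
  have key : ∀ v ∈ s, simplexBoundary V
      (Finsupp.single (s.erase v) ((-1 : ℤ) ^ (s.filter (· < v)).card)) =
      ∑ w ∈ s.erase v, Finsupp.single ((s.erase v).erase w)
        ((-1 : ℤ) ^ (s.filter (· < v)).card * (-1) ^ ((s.erase v).filter (· < w)).card) := by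
    intro v _
    rw [← mul_one ((-1 : ℤ) ^ (s.filter (· < v)).card), ← smul_eq_mul, ← Finsupp.smul_single,
      map_smul, simplexBoundary_single, Finset.smul_sum]
    refine Finset.sum_congr rfl fun w _ => ?_
    rw [Finsupp.smul_single, smul_eq_mul, smul_eq_mul, mul_one]
  rw [Finset.sum_congr rfl key, Finset.sum_sigma']
  refine Finset.sum_involution (fun p _ => ⟨p.2, p.1⟩) ?_ ?_ ?_ ?_
  · rintro ⟨v, w⟩ hp
    simp only [Finset.mem_sigma, Finset.mem_erase] at hp
    obtain ⟨hv, hwv, hw⟩ := hp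
    dsimp only
    rw [Finset.erase_right_comm (a := w) (b := v), ← Finsupp.single_add]
    rcases lt_or_gt_of_ne hwv with h | h
    · rw [add_comm, simplexBoundary_sign s hw h, Finsupp.single_zero]
    · rw [simplexBoundary_sign s hv h, Finsupp.single_zero]
  · rintro ⟨v, w⟩ hp _ heq
    simp only [Finset.mem_sigma, Finset.mem_erase] at hp
    exact hp.2.1 (Sigma.mk.inj_iff.mp heq).1
  · rintro ⟨v, w⟩ hp
    simp only [Finset.mem_sigma, Finset.mem_erase] at hp ⊢
    exact ⟨hp.2.2, hp.2.1.symm, hp.1⟩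
  · rintro ⟨v, w⟩ _
    rfl

end Chains

namespace PreAbstractSimplicialComplex

/-- The simplices of a simplicial complex, the empty simplex included (Mathlib's `faces` are the
nonempty simplices). -/
def simplices {V : Type u} (K : PreAbstractSimplicialComplex V) : Set (Finset V) :=
  insert ∅ K.faces

lemma mem_simplices_of_subset {V : Type u} (K : PreAbstractSimplicialComplex V) {s t : Finset V}
    (hs : s ∈ K.simplices) (hts : t ⊆ s) : t ∈ K.simplices := by
  rcases t.eq_empty_or_nonempty with rfl | ht
  · exact Or.inl rfl
  · rcases hs with rfl | hs
    · exact absurd (Finset.subset_empty.mp hts) ht.ne_empty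
    · exact Or.inr ((K.isRelLowerSet_faces hs).2 hts ht)

/-- The module of `i`-chains: the free abelian group on the simplices of dimension `i`, that is,
with `i + 1` vertices. The empty simplex has dimension `-1`. -/
noncomputable def chains {V : Type u} (K : PreAbstractSimplicialComplex V) (i : ℤ) :
    Submodule ℤ (Finset V →₀ ℤ) :=
  Finsupp.supported ℤ ℤ {s | s ∈ K.simplices ∧ (s.card : ℤ) = i + 1}

lemma simplexBoundary_mem_chains {V : Type u} [LinearOrder V] (K : PreAbstractSimplicialComplex V)
    {i j : ℤ} (hij : j + 1 = i) :
    ∀ c ∈ K.chains i, simplexBoundary V c ∈ K.chains j := by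
  intro c hc
  rw [simplexBoundary, Finsupp.linearCombination_apply]
  refine Submodule.sum_mem _ fun s hs => Submodule.smul_mem _ _ (Submodule.sum_mem _ fun v hv => ?_)
  obtain ⟨hsK, hcard⟩ := (Finsupp.mem_supported ℤ c).mp hc hs
  refine Finsupp.single_mem_supported ℤ _ ⟨K.mem_simplices_of_subset hsK (s.erase_subset v), ?_⟩
  have := Finset.card_erase_add_one hv
  omega

/-- The augmented simplicial chain complex with integer coefficients
`⋯ → C₁ → C₀ → C₋₁ = ℤ → 0`. -/
noncomputable def reducedChainComplex {V : Type u} [LinearOrder V]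
    (K : PreAbstractSimplicialComplex V) : ChainComplex (ModuleCat.{u} ℤ) ℤ where
  X i := ModuleCat.of ℤ (K.chains i)
  d i j := if h : j + 1 = i then
    ModuleCat.ofHom ((simplexBoundary V).restrict (K.simplexBoundary_mem_chains h)) else 0
  shape i j h := dif_neg h
  d_comp_d' i j k hij hjk := by
    have hij' : j + 1 = i := hij
    have hjk' : k + 1 = j := hjk
    rw [dif_pos hij', dif_pos hjk']
    exact ModuleCat.hom_ext (LinearMap.ext fun c =>
      Subtype.ext (LinearMap.congr_fun simplexBoundary_comp_self c.1))

/-- The reduced simplicial homology with integer coefficients, in degree `i : ℤ`. -/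
noncomputable abbrev reducedHomology {V : Type u} [LinearOrder V]
    (K : PreAbstractSimplicialComplex V) (i : ℤ) : ModuleCat.{u} ℤ :=
  K.reducedChainComplex.homology i

/-- The join of two simplicial complexes: its simplices are the disjoint unions of a simplex of
`K` and a simplex of `L`. The vertices of `K` are put before those of `L`. -/
def join {V W : Type u} (K : PreAbstractSimplicialComplex V) (L : PreAbstractSimplicialComplex W) :
    PreAbstractSimplicialComplex (V ⊕ₗ W) where
  faces := {s | s.Nonempty ∧ ∃ a ∈ K.simplices, ∃ b ∈ L.simplices,
    s = (a.disjSum b).map toLex.toEmbedding}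
  isRelLowerSet_faces := by
    rintro s ⟨hs, a, ha, b, hb, rfl⟩
    refine ⟨hs, fun t hts ht => ⟨ht, ?_⟩⟩
    refine ⟨(t.map ofLex.toEmbedding).toLeft,
      K.mem_simplices_of_subset ha fun x hx => ?_,
      (t.map ofLex.toEmbedding).toRight,
      L.mem_simplices_of_subset hb fun x hx => ?_, ?_⟩
    · obtain ⟨y, hy, hyx⟩ := Finset.mem_map.mp (Finset.mem_toLeft.mp hx)
      obtain ⟨z, hz, rfl⟩ := Finset.mem_map.mp (hts hy)
      have hzx : z = Sum.inl x := hyx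
      rw [hzx] at hz
      exact Finset.inl_mem_disjSum.mp hz
    · obtain ⟨y, hy, hyx⟩ := Finset.mem_map.mp (Finset.mem_toRight.mp hx)
      obtain ⟨z, hz, rfl⟩ := Finset.mem_map.mp (hts hy)
      have hzx : z = Sum.inr x := hyx
      rw [hzx] at hz
      exact Finset.inr_mem_disjSum.mp hz
    · rw [Finset.toLeft_disjSum_toRight, Finset.map_map]
      ext x
      simp

/-- The vertex set of the join of `n` copies of a complex with vertex set `V`: the disjoint union
of `n` copies of `V`, ordered one copy after the other. -/
def JoinPowerVertex (V : Type u) : ℕ → Type u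
  | 0 => PEmpty
  | n + 1 => JoinPowerVertex V n ⊕ₗ V

/-- The linear order on the vertices of the join of `n` copies. -/
noncomputable instance JoinPowerVertex.instLinearOrder (V : Type u) [LinearOrder V] :
    (n : ℕ) → LinearOrder (JoinPowerVertex V n)
  | 0 => inferInstanceAs (LinearOrder PEmpty)
  | n + 1 =>
    haveI := JoinPowerVertex.instLinearOrder V n
    inferInstanceAs (LinearOrder (JoinPowerVertex V n ⊕ₗ V))

/-- The join of `n` copies of `K`, obtained by successively joining one copy at a time to the
complex `{∅}`, the unit of the join. -/
def joinPower {V : Type u} (K : PreAbstractSimplicialComplex V) :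
    (n : ℕ) → PreAbstractSimplicialComplex (JoinPowerVertex V n)
  | 0 => (⊥ : PreAbstractSimplicialComplex PEmpty)
  | n + 1 => join (joinPower K n) K

end PreAbstractSimplicialComplex

/-- The disjoint union of a square and a point: the complex
`{∅, 1, 2, 3, 4, 5, 12, 23, 34, 41}`, with the vertex `k` written as `k - 1`. -/
def squareAndPoint : PreAbstractSimplicialComplex (Fin 5) where
  faces := {s | s ∈ ({{0}, {1}, {2}, {3}, {4}, {0, 1}, {1, 2}, {2, 3}, {3, 0}} :
    Finset (Finset (Fin 5)))}
  isRelLowerSet_faces := by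
    have h : ∀ s ∈ ({{0}, {1}, {2}, {3}, {4}, {0, 1}, {1, 2}, {2, 3}, {3, 0}} :
        Finset (Finset (Fin 5))), s.Nonempty ∧ ∀ t ∈ s.powerset, t.Nonempty →
        t ∈ ({{0}, {1}, {2}, {3}, {4}, {0, 1}, {1, 2}, {2, 3}, {3, 0}} :
          Finset (Finset (Fin 5))) := by
      decide
    exact fun s hs => ⟨(h s hs).1, fun t hts ht => (h s hs).2 t (Finset.mem_powerset.mpr hts) ht⟩

/-! With augmented chains, a join is a tensor product up to a degree shift by one. The augmented
complex of the square with a point is homotopy equivalent to two copies of `ℤ`, in degrees 0 and 1,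
with zero differential (`squareAndPointSplitting`). Joining with it therefore gives `H̃_i(K * X) ≅
H̃_{i-1}(K) ⊕ H̃_{i-2}(K)`, with no Künneth theorem and no Tor terms. Starting from `{∅}`, whose
homology is `ℤ` in degree -1, Pascal's rule (`joinPowerRank_succ`) yields the binomial ranks.

The induction carries explicit data, a `HomologyModel`, rather than an abstract isomorphism:
representing cycles are joined with the cycles of `X`, and coordinates are pulled back by slant
products with the dual cocycles. `ChainSplitting.joinModel` is the inductive step; the Leibniz rule
`simplexBoundary_joinChain` and the homotopy formula `joinOperator_spec` carry it. -/

namespace PreAbstractSimplicialComplex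

/-! ### Homology presented by cycles and coordinates -/

section HomologyModel

/-- A linear map on the middle term of a short complex which vanishes on the image of the first
map, and is surjective on cycles, with only boundaries as kernel, identifies the homology. -/
theorem nonempty_homology_equiv {R : Type*} [Ring R]
    (S : ShortComplex (ModuleCat.{u} R)) {A : Type*} [AddCommGroup A] [Module R A]
    (p : S.X₂ →ₗ[R] A) (hf : ∀ x, p (S.f.hom x) = 0) (hp : ∀ a, ∃ x, S.g.hom x = 0 ∧ p x = a)
    (hker : ∀ x, S.g.hom x = 0 → p x = 0 → ∃ y, S.f.hom y = x) :
    Nonempty (S.homology ≃ₗ[R] A) := by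
  let q : LinearMap.ker S.g.hom →ₗ[R] A := p ∘ₗ (LinearMap.ker S.g.hom).subtype
  have hq : Function.Surjective q := fun a => by
    obtain ⟨x, hx, hxa⟩ := hp a
    exact ⟨⟨x, hx⟩, hxa⟩
  have hrange : LinearMap.range S.moduleCatToCycles = LinearMap.ker q := by
    ext x
    constructor
    · rintro ⟨y, rfl⟩
      exact hf y
    · intro hx
      obtain ⟨y, hy⟩ := hker x.1 x.2 hx
      exact ⟨y, Subtype.ext hy⟩
  exact ⟨S.moduleCatHomologyIso.toLinearEquiv ≪≫ₗ
    (Submodule.quotEquivOfEq _ _ hrange ≪≫ₗ q.quotKerEquivOfSurjective hq)⟩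

variable {V : Type u} [LinearOrder V]

/-- A presentation of the reduced homology of `K` in degree `i` by the module `A`: representing
cycles for the elements of `A`, and coordinates in `A` which vanish on boundaries and determine a
cycle up to a boundary. -/
structure HomologyModel (K : PreAbstractSimplicialComplex V) (i : ℤ) (A : Type*) [AddCommGroup A]
    where
  /-- The representing cycles. -/
  cycle : A →ₗ[ℤ] (Finset V →₀ ℤ)
  /-- The coordinates. -/
  coord : (Finset V →₀ ℤ) →ₗ[ℤ] A
  cycle_mem : ∀ a, cycle a ∈ K.chains i
  boundary_cycle : ∀ a, simplexBoundary V (cycle a) = 0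
  coord_boundary : ∀ c ∈ K.chains (i + 1), coord (simplexBoundary V c) = 0
  coord_cycle : ∀ a, coord (cycle a) = a
  exists_boundary : ∀ c ∈ K.chains i, simplexBoundary V c = 0 →
    ∃ b ∈ K.chains (i + 1), simplexBoundary V b = c - cycle (coord c)

namespace HomologyModel

variable {K : PreAbstractSimplicialComplex V} {i : ℤ} {A B : Type*} [AddCommGroup A]
  [AddCommGroup B]

/-- Transport of a model along an isomorphism of modules. -/
noncomputable def congr (D : HomologyModel K i A) (e : A ≃ₗ[ℤ] B) : HomologyModel K i B where
  cycle := D.cycle ∘ₗ e.symm.toLinearMap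
  coord := e.toLinearMap ∘ₗ D.coord
  cycle_mem b := D.cycle_mem _
  boundary_cycle b := D.boundary_cycle _
  coord_boundary c hc := by simp [D.coord_boundary c hc]
  coord_cycle b := by simp [D.coord_cycle]
  exists_boundary c hc h := by simpa using D.exists_boundary c hc h

/-- The module of a model is isomorphic to the reduced homology. -/
theorem nonempty_equiv (D : HomologyModel K i A) : Nonempty (K.reducedHomology i ≃ₗ[ℤ] A) := by
  have hi : (ComplexShape.down ℤ).prev i = i + 1 := (ComplexShape.down ℤ).prev_eq' (by simp)
  have hk : (ComplexShape.down ℤ).next i = i - 1 := (ComplexShape.down ℤ).next_eq' (by simp)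
  have hf : (K.reducedChainComplex.sc' (i + 1) i (i - 1)).f = ModuleCat.ofHom
      ((simplexBoundary V).restrict (K.simplexBoundary_mem_chains (i := i + 1) rfl)) :=
    dif_pos rfl
  have hg : (K.reducedChainComplex.sc' (i + 1) i (i - 1)).g = ModuleCat.ofHom
      ((simplexBoundary V).restrict (K.simplexBoundary_mem_chains (sub_add_cancel i 1))) :=
    dif_pos (sub_add_cancel i 1)
  obtain ⟨e⟩ := nonempty_homology_equiv (K.reducedChainComplex.sc' (i + 1) i (i - 1))
    (D.coord ∘ₗ (K.chains i).subtype)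
    (by
      rw [hf]
      exact fun x => D.coord_boundary _ (Subtype.property x))
    (by
      rw [hg]
      exact fun a => ⟨⟨D.cycle a, D.cycle_mem a⟩, Subtype.ext (D.boundary_cycle a),
        D.coord_cycle a⟩)
    (by
      rw [hf, hg]
      intro x hx hx0
      obtain ⟨b, hb, hbx⟩ := D.exists_boundary _ (Subtype.property x) (congrArg Subtype.val hx)
      have hx0' : D.coord (Subtype.val x) = 0 := hx0
      rw [hx0', map_zero, sub_zero] at hbx
      exact ⟨⟨b, hb⟩, Subtype.ext hbx⟩)
  exact ⟨(ShortComplex.homologyMapIso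
    (K.reducedChainComplex.isoSc' (i + 1) i (i - 1) hi hk)).toLinearEquiv ≪≫ₗ e⟩

end HomologyModel

end HomologyModel

/-! ### Chains of a join as a tensor product -/

section JoinChains

variable {V W : Type u}

/-- The union of a set of vertices of the first factor and one of the second. -/
def joinSimplex (s : Finset V) (t : Finset W) : Finset (V ⊕ₗ W) :=
  (s.disjSum t).map toLex.toEmbedding

/-- The part of a set of vertices of a join in the first factor. -/
def leftPart (x : Finset (V ⊕ₗ W)) : Finset V := (x.map ofLex.toEmbedding).toLeft

/-- The part of a set of vertices of a join in the second factor. -/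
def rightPart (x : Finset (V ⊕ₗ W)) : Finset W := (x.map ofLex.toEmbedding).toRight

@[simp] lemma leftPart_joinSimplex (s : Finset V) (t : Finset W) :
    leftPart (joinSimplex s t) = s := by
  ext x; simp [leftPart, joinSimplex]

@[simp] lemma rightPart_joinSimplex (s : Finset V) (t : Finset W) :
    rightPart (joinSimplex s t) = t := by
  ext x; simp [rightPart, joinSimplex]

@[simp] lemma card_joinSimplex (s : Finset V) (t : Finset W) :
    (joinSimplex s t).card = s.card + t.card := by
  simp [joinSimplex]

lemma mem_simplices_join {K : PreAbstractSimplicialComplex V} {L : PreAbstractSimplicialComplex W}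
    {x : Finset (V ⊕ₗ W)} : x ∈ (join K L).simplices ↔
      ∃ s ∈ K.simplices, ∃ t ∈ L.simplices, x = joinSimplex s t := by
  constructor
  · rintro (rfl | ⟨-, h⟩)
    · exact ⟨∅, Or.inl rfl, ∅, Or.inl rfl, by simp [joinSimplex]⟩
    · exact h
  · intro h
    rcases x.eq_empty_or_nonempty with rfl | hx
    · exact Or.inl rfl
    · exact Or.inr ⟨hx, h⟩

/-- The join of chains, as a bilinear map. -/
noncomputable def joinChain :
    (Finset V →₀ ℤ) →ₗ[ℤ] (Finset W →₀ ℤ) →ₗ[ℤ] (Finset (V ⊕ₗ W) →₀ ℤ) :=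
  Finsupp.linearCombination ℤ fun s => Finsupp.lmapDomain ℤ ℤ (joinSimplex s)

@[simp] lemma joinChain_single (s : Finset V) (t : Finset W) (a b : ℤ) :
    joinChain (Finsupp.single s a) (Finsupp.single t b) =
      Finsupp.single (joinSimplex s t) (a * b) := by
  simp [joinChain]

/-- The linear map on the chains of a join induced by a bilinear map. -/
noncomputable def joinLift {N : Type*} [AddCommGroup N]
    (B : (Finset V →₀ ℤ) →ₗ[ℤ] (Finset W →₀ ℤ) →ₗ[ℤ] N) : (Finset (V ⊕ₗ W) →₀ ℤ) →ₗ[ℤ] N :=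
  Finsupp.linearCombination ℤ fun x =>
    B (Finsupp.single (leftPart x) 1) (Finsupp.single (rightPart x) 1)

/-- A simplex of the join is recovered from its two parts, so this is the universal property of the
tensor product. -/
lemma joinLift_joinChain {N : Type*} [AddCommGroup N]
    (B : (Finset V →₀ ℤ) →ₗ[ℤ] (Finset W →₀ ℤ) →ₗ[ℤ] N) (c : Finset V →₀ ℤ) (z : Finset W →₀ ℤ) :
    joinLift B (joinChain c z) = B c z := by
  have : joinChain.compr₂ (joinLift B) = B := by
    ext s t
    simp [joinLift]
  exact LinearMap.congr_fun₂ this c z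

/-- Multiplication of every simplex by the parity of its number of vertices. -/
noncomputable def signTwist (V : Type u) : (Finset V →₀ ℤ) →ₗ[ℤ] (Finset V →₀ ℤ) :=
  Finsupp.linearCombination ℤ fun s => Finsupp.single s ((-1) ^ s.card)

lemma signTwist_single (s : Finset V) (a : ℤ) :
    signTwist V (Finsupp.single s a) = Finsupp.single s (a * (-1) ^ s.card) := by
  simp [signTwist]

lemma signTwist_signTwist (c : Finset V →₀ ℤ) : signTwist V (signTwist V c) = c := by
  have : signTwist V ∘ₗ signTwist V = LinearMap.id := by
    ext1 s
    ext1
    simp [signTwist_single, ← pow_add]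
  exact LinearMap.congr_fun this c

lemma single_mem_chains {K : PreAbstractSimplicialComplex V} {s : Finset V} (hs : s ∈ K.simplices)
    {i : ℤ} (hi : (s.card : ℤ) = i + 1) (a : ℤ) : Finsupp.single s a ∈ K.chains i :=
  Finsupp.single_mem_supported ℤ _ ⟨hs, hi⟩

lemma chains_induction {K : PreAbstractSimplicialComplex V} {i : ℤ} {p : (Finset V →₀ ℤ) → Prop}
    (zero : p 0) (add : ∀ c d, p c → p d → p (c + d)) (smul : ∀ (a : ℤ) c, p c → p (a • c))
    (single : ∀ s ∈ K.simplices, (s.card : ℤ) = i + 1 → p (Finsupp.single s 1))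
    {c : Finset V →₀ ℤ} (hc : c ∈ K.chains i) : p c := by
  rw [chains, Finsupp.supported_eq_span_single] at hc
  induction hc using Submodule.span_induction with
  | mem x hx =>
    obtain ⟨s, ⟨hs, hi⟩, rfl⟩ := hx
    exact single s hs hi
  | zero => exact zero
  | add x y _ _ hx hy => exact add x y hx hy
  | smul a x _ hx => exact smul a x hx

lemma map_mem_of_chains {N : Type*} [AddCommGroup N] {K : PreAbstractSimplicialComplex V} {i : ℤ}
    (f : (Finset V →₀ ℤ) →ₗ[ℤ] N) (P : Submodule ℤ N)
    (h : ∀ s ∈ K.simplices, (s.card : ℤ) = i + 1 → f (Finsupp.single s 1) ∈ P)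
    {c : Finset V →₀ ℤ} (hc : c ∈ K.chains i) : f c ∈ P :=
  chains_induction (p := fun c => f c ∈ P) (by simp)
    (fun c d hc hd => by simpa using P.add_mem hc hd)
    (fun a c hc => by simpa using P.smul_mem a hc) h hc

lemma eq_on_chains {N : Type*} [AddCommGroup N] {K : PreAbstractSimplicialComplex V} {i : ℤ}
    {f g : (Finset V →₀ ℤ) →ₗ[ℤ] N}
    (h : ∀ s ∈ K.simplices, (s.card : ℤ) = i + 1 → f (Finsupp.single s 1) = g (Finsupp.single s 1))
    {c : Finset V →₀ ℤ} (hc : c ∈ K.chains i) : f c = g c := by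
  have := map_mem_of_chains (f - g) ⊥ (fun s hs hi => by simp [h s hs hi]) hc
  simpa [sub_eq_zero] using this

lemma signTwist_mem_chains {K : PreAbstractSimplicialComplex V} {i : ℤ} {c : Finset V →₀ ℤ}
    (hc : c ∈ K.chains i) : signTwist V c ∈ K.chains i :=
  map_mem_of_chains _ _ (fun s hs hi => by
    rw [signTwist_single]
    exact single_mem_chains hs hi _) hc

lemma joinChain_mem_chains {K : PreAbstractSimplicialComplex V} {L : PreAbstractSimplicialComplex W}
    {i j k : ℤ} (hk : i + j + 1 = k) {c : Finset V →₀ ℤ} {z : Finset W →₀ ℤ} (hc : c ∈ K.chains i)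
    (hz : z ∈ L.chains j) : joinChain c z ∈ (join K L).chains k := by
  refine map_mem_of_chains (joinChain.flip z) _ (fun s hs hi => ?_) hc
  refine map_mem_of_chains (joinChain (Finsupp.single s 1)) _ (fun t ht hj => ?_) hz
  rw [joinChain_single]
  refine single_mem_chains (mem_simplices_join.mpr ⟨s, hs, t, ht, rfl⟩) ?_ _
  rw [card_joinSimplex]
  push_cast
  omega

/-- Joins of simplices span the chains of a join. The test chains are homogeneous but otherwise
arbitrary, so that properties of a splitting, stated for chains, apply directly. -/
lemma map_join_mem {N : Type*} [AddCommGroup N] {K : PreAbstractSimplicialComplex V}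
    {L : PreAbstractSimplicialComplex W} {k : ℤ}
    (f : (Finset (V ⊕ₗ W) →₀ ℤ) →ₗ[ℤ] N) (P : Submodule ℤ N)
    (h : ∀ i j, i + j + 1 = k → ∀ c ∈ K.chains i, ∀ z ∈ L.chains j, f (joinChain c z) ∈ P)
    {x : Finset (V ⊕ₗ W) →₀ ℤ} (hx : x ∈ (join K L).chains k) : f x ∈ P := by
  refine map_mem_of_chains f P (fun u hu hk => ?_) hx
  obtain ⟨s, hs, t, ht, rfl⟩ := mem_simplices_join.mp hu
  rw [card_joinSimplex] at hk
  push_cast at hk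
  have := h (s.card - 1) (t.card - 1) (by omega) _ (single_mem_chains hs (by simp) 1) _
    (single_mem_chains ht (by simp) 1)
  simpa using this

lemma eq_on_join_chains {N : Type*} [AddCommGroup N] {K : PreAbstractSimplicialComplex V}
    {L : PreAbstractSimplicialComplex W} {k : ℤ}
    {f g : (Finset (V ⊕ₗ W) →₀ ℤ) →ₗ[ℤ] N}
    (h : ∀ i j, i + j + 1 = k → ∀ c ∈ K.chains i, ∀ z ∈ L.chains j,
      f (joinChain c z) = g (joinChain c z))
    {x : Finset (V ⊕ₗ W) →₀ ℤ} (hx : x ∈ (join K L).chains k) : f x = g x := by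
  have := map_join_mem (f - g) ⊥ (fun i j hij c hc z hz => by simp [h i j hij c hc z hz]) hx
  simpa [sub_eq_zero] using this

variable [LinearOrder V] [LinearOrder W]

/-- The boundary removes one vertex and so flips the parity. -/
lemma signTwist_simplexBoundary (c : Finset V →₀ ℤ) :
    signTwist V (simplexBoundary V c) = -simplexBoundary V (signTwist V c) := by
  have : signTwist V ∘ₗ simplexBoundary V = -(simplexBoundary V ∘ₗ signTwist V) := by
    ext1 s
    ext1
    have h1 : signTwist V (Finsupp.single s 1) = (-1 : ℤ) ^ s.card • Finsupp.single s 1 := by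
      simp [signTwist_single]
    simp only [LinearMap.comp_apply, Finsupp.lsingle_apply, LinearMap.neg_apply]
    rw [h1, map_smul, simplexBoundary_single, map_sum, Finset.smul_sum, ← Finset.sum_neg_distrib]
    refine Finset.sum_congr rfl fun v hv => ?_
    rw [signTwist_single, Finsupp.smul_single, ← Finset.card_erase_add_one hv, pow_succ,
      ← Finsupp.single_neg]
    congr 1
    simp only [smul_eq_mul]
    ring
  exact LinearMap.congr_fun this c

/-- The graded Leibniz rule. All vertices of the first factor precede those of the second, so
removing a vertex of the second factor costs the extra sign `(-1) ^ s.card`, which is the sign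
twist. -/
lemma simplexBoundary_joinChain (c : Finset V →₀ ℤ) (z : Finset W →₀ ℤ) :
    simplexBoundary (V ⊕ₗ W) (joinChain c z) =
      joinChain (simplexBoundary V c) z + joinChain (signTwist V c) (simplexBoundary W z) := by
  have : joinChain.compr₂ (simplexBoundary (V ⊕ₗ W)) =
      joinChain ∘ₗ simplexBoundary V +
        (joinChain ∘ₗ signTwist V).compl₂ (simplexBoundary W) := by
    ext1 s
    ext1
    ext1 t
    ext1
    simp only [LinearMap.compr₂_apply, LinearMap.comp_apply, Finsupp.lsingle_apply,
      LinearMap.add_apply, LinearMap.compl₂_apply, joinChain_single, mul_one,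
      simplexBoundary_single, map_sum, LinearMap.sum_apply, signTwist_single, one_mul]
    rw [joinSimplex, Finset.sum_map, Finset.sum_disjSum]
    congr 1
    · refine Finset.sum_congr rfl fun v _ => ?_
      congr 2
      · ext x
        obtain ⟨x, rfl⟩ := toLex.surjective x
        rcases x with x | x <;> simp [joinSimplex]
      · have : ((s.disjSum t).map toLex.toEmbedding).filter (· < toLex (Sum.inl v)) =
            joinSimplex (s.filter (· < v)) ∅ := by
          ext x
          obtain ⟨x, rfl⟩ := toLex.surjective x
          rcases x with x | x <;> simp [joinSimplex]
        exact (congrArg Finset.card this).trans (by simp)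
    · refine Finset.sum_congr rfl fun w _ => ?_
      rw [← pow_add]
      congr 2
      · ext x
        obtain ⟨x, rfl⟩ := toLex.surjective x
        rcases x with x | x <;> simp [joinSimplex]
      · have : ((s.disjSum t).map toLex.toEmbedding).filter (· < toLex (Sum.inr w)) =
            joinSimplex s (t.filter (· < w)) := by
          ext x
          obtain ⟨x, rfl⟩ := toLex.surjective x
          rcases x with x | x <;> simp [joinSimplex]
        exact (congrArg Finset.card this).trans (by simp)
  exact LinearMap.congr_fun₂ this c z

end JoinChains

end PreAbstractSimplicialComplex

/-! ### Joining with a complex whose chains split -/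

namespace PreAbstractSimplicialComplex

/-- A splitting of the augmented chain complex of `L` up to homotopy into copies of `ℤ`, indexed by
`κ` and with zero differential: cycles, dual cocycles, and a homotopy from the identity to the
projection onto the span of the cycles. -/
structure ChainSplitting {W : Type u} [LinearOrder W] (L : PreAbstractSimplicialComplex W)
    (κ : Type*) [Fintype κ] [DecidableEq κ] where
  /-- The degrees of the cycles. -/
  degree : κ → ℤ
  /-- The cycles. -/
  cycle : κ → Finset W →₀ ℤ
  /-- The dual cocycles. -/
  cochain : κ → (Finset W →₀ ℤ) →ₗ[ℤ] ℤ
  /-- The homotopy. -/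
  homotopy : (Finset W →₀ ℤ) →ₗ[ℤ] (Finset W →₀ ℤ)
  cycle_mem : ∀ k, cycle k ∈ L.chains (degree k)
  boundary_cycle : ∀ k, simplexBoundary W (cycle k) = 0
  cochain_eq_zero : ∀ k, ∀ j, j ≠ degree k → ∀ z ∈ L.chains j, cochain k z = 0
  cochain_boundary : ∀ k, ∀ j, ∀ z ∈ L.chains j, cochain k (simplexBoundary W z) = 0
  cochain_cycle : ∀ k l, cochain k (cycle l) = if l = k then 1 else 0
  homotopy_mem : ∀ j, ∀ z ∈ L.chains j, homotopy z ∈ L.chains (j + 1)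
  homotopy_spec : ∀ j, ∀ z ∈ L.chains j,
    simplexBoundary W (homotopy z) + homotopy (simplexBoundary W z) =
      z - ∑ k, cochain k z • cycle k

section Join

variable {V W : Type u}

/-- The slant product of the chains of a join with a cochain of the second factor. -/
noncomputable def slant (φ : (Finset W →₀ ℤ) →ₗ[ℤ] ℤ) :
    (Finset (V ⊕ₗ W) →₀ ℤ) →ₗ[ℤ] (Finset V →₀ ℤ) :=
  joinLift ((LinearMap.lsmul ℤ (Finset V →₀ ℤ) ∘ₗ φ).flip)

lemma slant_joinChain (φ : (Finset W →₀ ℤ) →ₗ[ℤ] ℤ) (c : Finset V →₀ ℤ) (z : Finset W →₀ ℤ) :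
    slant φ (joinChain c z) = φ z • c := by
  simp [slant, joinLift_joinChain]

/-- The extension to the chains of a join of an odd operator on the chains of the second factor. -/
noncomputable def joinOperator (h : (Finset W →₀ ℤ) →ₗ[ℤ] (Finset W →₀ ℤ)) :
    (Finset (V ⊕ₗ W) →₀ ℤ) →ₗ[ℤ] (Finset (V ⊕ₗ W) →₀ ℤ) :=
  joinLift ((joinChain ∘ₗ signTwist V).compl₂ h)

lemma joinOperator_joinChain (h : (Finset W →₀ ℤ) →ₗ[ℤ] (Finset W →₀ ℤ)) (c : Finset V →₀ ℤ)
    (z : Finset W →₀ ℤ) : joinOperator h (joinChain c z) = joinChain (signTwist V c) (h z) := by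
  simp [joinOperator, joinLift_joinChain]

variable [LinearOrder W] {K : PreAbstractSimplicialComplex V}
  {L : PreAbstractSimplicialComplex W} {κ : Type*} [Fintype κ] [DecidableEq κ]

namespace ChainSplitting

variable (S : ChainSplitting L κ)

lemma slant_mem {i : ℤ} (k : κ) {x : Finset (V ⊕ₗ W) →₀ ℤ} (hx : x ∈ (join K L).chains i) :
    slant (S.cochain k) x ∈ K.chains (i - S.degree k - 1) := by
  refine map_join_mem _ _ (fun a b hab c hc z hz => ?_) hx
  rw [slant_joinChain]
  by_cases hb : b = S.degree k
  · refine Submodule.smul_mem _ _ ?_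
    rwa [show i - S.degree k - 1 = a by omega]
  · rw [S.cochain_eq_zero k b hb z hz, zero_smul]
    exact Submodule.zero_mem _

variable [LinearOrder V] in
-- In the Leibniz rule the term with the boundary in the second factor dies because the cochain is a
-- cocycle; the other term has no sign.
lemma slant_boundary {i : ℤ} (k : κ) {x : Finset (V ⊕ₗ W) →₀ ℤ} (hx : x ∈ (join K L).chains i) :
    slant (S.cochain k) (simplexBoundary (V ⊕ₗ W) x) =
      simplexBoundary V (slant (S.cochain k) x) := by
  refine eq_on_join_chains (f := slant (S.cochain k) ∘ₗ simplexBoundary (V ⊕ₗ W))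
    (g := simplexBoundary V ∘ₗ slant (S.cochain k)) (fun a b _ c _ z hz => ?_) hx
  simp [simplexBoundary_joinChain, slant_joinChain, S.cochain_boundary k b z hz]

lemma joinOperator_mem {i : ℤ} {x : Finset (V ⊕ₗ W) →₀ ℤ} (hx : x ∈ (join K L).chains i) :
    joinOperator S.homotopy x ∈ (join K L).chains (i + 1) := by
  refine map_join_mem _ _ (fun a b hab c hc z hz => ?_) hx
  rw [joinOperator_joinChain]
  exact joinChain_mem_chains (by omega) (signTwist_mem_chains hc) (S.homotopy_mem b z hz)

variable [LinearOrder V]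

/-- The sign twist in `joinOperator` anticommutes with the boundary, so the two terms containing the
boundary of the first factor cancel; as its square is the identity, what remains is the homotopy
formula of `L`, joined with `c`. -/
lemma joinOperator_spec {i : ℤ} {x : Finset (V ⊕ₗ W) →₀ ℤ} (hx : x ∈ (join K L).chains i) :
    simplexBoundary (V ⊕ₗ W) (joinOperator S.homotopy x) +
      joinOperator S.homotopy (simplexBoundary (V ⊕ₗ W) x) =
      x - ∑ k, joinChain (slant (S.cochain k) x) (S.cycle k) := by
  have := eq_on_join_chains (K := K) (L := L) (k := i)
    (f := simplexBoundary (V ⊕ₗ W) ∘ₗ joinOperator S.homotopy +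
      joinOperator S.homotopy ∘ₗ simplexBoundary (V ⊕ₗ W))
    (g := LinearMap.id - ∑ k, joinChain.flip (S.cycle k) ∘ₗ slant (S.cochain k))
    (fun a b _ c _ z hz => ?_) hx
  · simpa using this
  · have h := congrArg (joinChain c) (S.homotopy_spec b z hz)
    simp only [map_add, map_sub, map_sum, map_smul] at h
    simp only [LinearMap.add_apply, LinearMap.comp_apply, joinOperator_joinChain,
      simplexBoundary_joinChain, map_add, signTwist_signTwist, signTwist_simplexBoundary,
      map_neg, LinearMap.neg_apply, LinearMap.sub_apply, LinearMap.id_apply,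
      LinearMap.sum_apply, slant_joinChain, map_smul, LinearMap.flip_apply]
    rw [← h]
    abel

/-- If the augmented chain complex of `L` splits, models for the homology of `K` give models for
the homology of the join of `K` and `L`. -/
noncomputable def joinModel (i : ℤ) {A : κ → Type*} [∀ k, AddCommGroup (A k)]
    (D : ∀ k, HomologyModel K (i - S.degree k - 1) (A k)) :
    HomologyModel (join K L) i (∀ k, A k) where
  cycle := ∑ k, joinChain.flip (S.cycle k) ∘ₗ (D k).cycle ∘ₗ LinearMap.proj k
  coord := LinearMap.pi fun k => (D k).coord ∘ₗ slant (S.cochain k)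
  cycle_mem a := by
    simp only [LinearMap.sum_apply]
    exact Submodule.sum_mem _ fun k _ =>
      joinChain_mem_chains (by omega) ((D k).cycle_mem _) (S.cycle_mem k)
  boundary_cycle a := by
    simp [simplexBoundary_joinChain, (D _).boundary_cycle, S.boundary_cycle]
  coord_boundary c hc := by
    funext k
    simp only [LinearMap.pi_apply, LinearMap.comp_apply, Pi.zero_apply]
    rw [S.slant_boundary k hc]
    refine (D k).coord_boundary _ ?_
    have := S.slant_mem k hc
    rwa [show i + 1 - S.degree k - 1 = i - S.degree k - 1 + 1 by ring] at this
  coord_cycle a := by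
    funext k
    have h : ∀ l, (D k).coord (slant (S.cochain k) (joinChain ((D l).cycle (a l)) (S.cycle l))) =
        if l = k then a k else 0 := fun l => by
      rw [slant_joinChain, S.cochain_cycle]
      split_ifs with hl
      · subst hl
        rw [one_smul, (D l).coord_cycle]
      · rw [zero_smul, map_zero]
    simp [h]
  exists_boundary x hx h := by
    have hcycle : ∀ k, simplexBoundary V (slant (S.cochain k) x) = 0 := fun k => by
      rw [← S.slant_boundary k hx, h, map_zero]
    choose b hb hbx using fun k => (D k).exists_boundary _ (S.slant_mem k hx) (hcycle k)
    -- The first summand bounds the difference of `x` and its projection to the joins `slant x *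
    -- cycle k`; the second replaces each slant by its representing cycle.
    refine ⟨joinOperator S.homotopy x + ∑ k, joinChain (b k) (S.cycle k),
      Submodule.add_mem _ (S.joinOperator_mem hx) (Submodule.sum_mem _ fun k _ =>
        joinChain_mem_chains (by omega) (hb k) (S.cycle_mem k)), ?_⟩
    have hx' := S.joinOperator_spec hx
    rw [h, map_zero, add_zero] at hx'
    simp [hx', simplexBoundary_joinChain, hbx, S.boundary_cycle]

end ChainSplitting

end Join

/-! ### The splitting for the square and the point -/

section SquareAndPoint

open Finsupp

/-- The contraction of the square onto the vertex `0`, through the path `0, 1, 2, 3`. -/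
noncomputable def squareHomotopy : (Finset (Fin 5) →₀ ℤ) →ₗ[ℤ] (Finset (Fin 5) →₀ ℤ) :=
  linearCombination ℤ fun s =>
    if s = ∅ then single {0} 1
    else if s = {1} then single {0, 1} 1
    else if s = {2} then single {0, 1} 1 + single {1, 2} 1
    else if s = {3} then single {0, 1} 1 + single {1, 2} 1 + single {2, 3} 1
    else 0

lemma squareAndPoint_simplices_cases {s : Finset (Fin 5)} (hs : s ∈ squareAndPoint.simplices) :
    s = ∅ ∨ s = {0} ∨ s = {1} ∨ s = {2} ∨ s = {3} ∨ s = {4} ∨ s = {0, 1} ∨ s = {1, 2} ∨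
      s = {2, 3} ∨ s = {0, 3} := by
  rcases hs with rfl | hs
  · simp
  · have h : s ∈ ({{0}, {1}, {2}, {3}, {4}, {0, 1}, {1, 2}, {2, 3}, {3, 0}} :
        Finset (Finset (Fin 5))) := hs
    -- The closing edge is written in increasing order, as `simplexBoundary_edge` requires.
    rw [Finset.pair_comm 3 0] at h
    simp only [Finset.mem_insert, Finset.mem_singleton] at h
    exact Or.inr h

lemma mem_squareAndPoint_simplices {s : Finset (Fin 5)}
    (hs : s ∈ ({{0}, {1}, {2}, {3}, {4}, {0, 1}, {1, 2}, {2, 3}, {3, 0}} :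
      Finset (Finset (Fin 5)))) : s ∈ squareAndPoint.simplices :=
  Or.inr hs

lemma simplexBoundary_vertex {V : Type u} [LinearOrder V] (v : V) :
    simplexBoundary V (single {v} 1) = single ∅ 1 := by
  simp [simplexBoundary_single, Finset.filter_singleton]

lemma simplexBoundary_edge {V : Type u} [LinearOrder V] {v w : V} (h : v < w) :
    simplexBoundary V (single {v, w} 1) = single {w} 1 - single {v} 1 := by
  rw [simplexBoundary_single, Finset.sum_pair h.ne, Finset.erase_insert (by simp [h.ne]),
    Finset.pair_comm, Finset.erase_insert (by simp [h.ne']),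
    Finset.filter_insert, Finset.filter_singleton, Finset.filter_insert, Finset.filter_singleton]
  simp [h, h.not_gt, sub_eq_add_neg]

lemma simplexBoundary_empty {V : Type u} [LinearOrder V] :
    simplexBoundary V (single ∅ 1) = 0 := by
  simp [simplexBoundary_single]

/-- The splitting of the chain complex of the disjoint union of a square and a point given by the
difference of two points in the two components, and the fundamental cycle of the square. -/
noncomputable def squareAndPointSplitting : ChainSplitting squareAndPoint (Fin 2) where
  degree := ![0, 1]
  -- The edge `{0, 3}` is oriented from 0 to 3, like the path through 1 and 2, hence the minus
  -- signs.
  cycle := ![single {4} 1 - single {0} 1,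
    single {0, 3} 1 - single {0, 1} 1 - single {1, 2} 1 - single {2, 3} 1]
  -- These coefficients are cocycles since neither simplex is a proper face of another one. They are
  -- also the two nonempty simplices outside the path `0, 1, 2, 3`, which is what the homotopy
  -- contracts.
  cochain := ![lapply {4}, lapply {0, 3}]
  homotopy := squareHomotopy
  cycle_mem k := by
    fin_cases k
    · exact Submodule.sub_mem _
        (single_mem_chains (mem_squareAndPoint_simplices (by decide)) (by simp) _)
        (single_mem_chains (mem_squareAndPoint_simplices (by decide)) (by simp) _)
    · refine Submodule.sub_mem _ (Submodule.sub_mem _ (Submodule.sub_mem _ ?_ ?_) ?_) ?_ <;>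
      exact single_mem_chains (mem_squareAndPoint_simplices (by decide)) (by simp) _
  boundary_cycle k := by
    fin_cases k
    · simp [simplexBoundary_vertex]
    · simp [simplexBoundary_edge]
  cochain_eq_zero k j hj z hz := by
    have key : ∀ s : Finset (Fin 5), (s.card : ℤ) ≠ j + 1 → z s = 0 := fun s hs => by
      by_contra h
      exact hs (hz (Finsupp.mem_support_iff.mpr h)).2
    fin_cases k
    · exact key _ fun h => hj (by simpa using h.symm)
    · exact key _ fun h => hj (by
        have h' : (2 : ℤ) = j + 1 := h
        change j = 1
        omega)
  cochain_boundary k j z hz := by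
    refine eq_on_chains (f := (![lapply {4}, lapply {0, 3}] : Fin 2 → _ →ₗ[ℤ] ℤ) k ∘ₗ
      simplexBoundary (Fin 5)) (g := 0) (fun s hs hj => ?_) hz
    rcases squareAndPoint_simplices_cases hs with
      rfl | rfl | rfl | rfl | rfl | rfl | rfl | rfl | rfl | rfl <;> fin_cases k <;>
    simp +decide [simplexBoundary_vertex, simplexBoundary_edge, simplexBoundary_empty]
  cochain_cycle k l := by
    fin_cases k <;> fin_cases l <;> simp +decide
  homotopy_mem j z hz := by
    refine map_mem_of_chains _ _ (fun s hs hj => ?_) hz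
    have edge : ∀ t : Finset (Fin 5), t ∈ ({{0}, {1}, {2}, {3}, {4}, {0, 1}, {1, 2}, {2, 3},
        {3, 0}} : Finset (Finset (Fin 5))) → t.card = s.card + 1 →
        single t 1 ∈ squareAndPoint.chains (j + 1) := fun t ht hc =>
      single_mem_chains (mem_squareAndPoint_simplices ht) (by rw [hc]; push_cast; omega) _
    simp only [squareHomotopy, linearCombination_single, one_smul]
    split_ifs with h h h h
    · exact edge _ (by decide) (by simp [h])
    · exact edge _ (by decide) (by simp [h])
    · exact Submodule.add_mem _ (edge _ (by decide) (by simp [h]))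
        (edge _ (by decide) (by simp [h]))
    · exact Submodule.add_mem _ (Submodule.add_mem _ (edge _ (by decide) (by simp [h]))
        (edge _ (by decide) (by simp [h]))) (edge _ (by decide) (by simp [h]))
    · exact Submodule.zero_mem _
  homotopy_spec j z hz := by
    have := eq_on_chains (K := squareAndPoint) (i := j)
      (f := simplexBoundary (Fin 5) ∘ₗ squareHomotopy + squareHomotopy ∘ₗ simplexBoundary (Fin 5))
      (g := LinearMap.id -
        ((lapply {4} : (Finset (Fin 5) →₀ ℤ) →ₗ[ℤ] ℤ).smulRight (single {4} 1 - single {0} 1) +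
        (lapply {0, 3} : (Finset (Fin 5) →₀ ℤ) →ₗ[ℤ] ℤ).smulRight
          (single {0, 3} 1 - single {0, 1} 1 - single {1, 2} 1 - single {2, 3} 1)))
      (fun s hs hj => ?_) hz
    · simpa using this
    -- The projection is nonzero only on `{4}` and `{0, 3}`. There the homotopy vanishes, and
    -- applied to the boundary it gives the vertex 0 and the path from 0 to 3.
    · rcases squareAndPoint_simplices_cases hs with
        rfl | rfl | rfl | rfl | rfl | rfl | rfl | rfl | rfl | rfl <;>
      simp +decide [simplexBoundary_vertex, simplexBoundary_edge, simplexBoundary_empty,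
        squareHomotopy]
      all_goals abel

end SquareAndPoint

/-! ### Ranks and the induction on the number of factors -/

/-- The rank of the reduced homology in degree `i` of the join of `n` copies of the disjoint union
of a square and a point. -/
def joinPowerRank (n : ℕ) (i : ℤ) : ℕ :=
  -- The guard is needed because `toNat` sends negative numbers to 0, where the binomial coefficient
  -- is 1. No upper guard is needed: the coefficient vanishes above `n`.
  if (n : ℤ) - 1 ≤ i then n.choose (i - n + 1).toNat else 0

lemma joinPowerRank_succ (n : ℕ) (i : ℤ) :
    joinPowerRank (n + 1) i = joinPowerRank n (i - 1) + joinPowerRank n (i - 2) := by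
  unfold joinPowerRank
  push_cast
  by_cases h : (n : ℤ) ≤ i
  · obtain ⟨m, rfl⟩ := Int.le.dest h
    rw [if_pos (by omega), if_pos (by omega),
      show ((n : ℤ) + m - (n + 1) + 1).toNat = m by omega,
      show ((n : ℤ) + m - 1 - n + 1).toNat = m by omega]
    -- In the lowest degree only one summand of Pascal's rule is present, the other being cut off by
    -- the guard.
    rcases m with _ | m
    · rw [if_neg (by push_cast; omega)]
      simp
    · rw [if_pos (by push_cast; omega), Nat.choose_succ_succ, add_comm,
        show ((n : ℤ) + (m + 1 : ℕ) - 2 - n + 1).toNat = m by omega]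
  · rw [if_neg (by omega), if_neg (by omega), if_neg (by omega)]

/-- The homology of the complex `{∅}`. -/
noncomputable def botHomologyModel {V : Type u} [LinearOrder V] (i : ℤ) :
    HomologyModel (⊥ : PreAbstractSimplicialComplex V) i (Fin (joinPowerRank 0 i) → ℤ) := by
  have hs : ∀ s ∈ (⊥ : PreAbstractSimplicialComplex V).simplices, s = ∅ := by
    rintro s (rfl | hs)
    · rfl
    · exact absurd hs (Set.notMem_empty s)
  have h0 : ∀ j : ℤ, j ≠ -1 → ∀ c ∈ (⊥ : PreAbstractSimplicialComplex V).chains j, c = 0 := by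
    intro j hj c hc
    refine eq_on_chains (f := LinearMap.id) (g := 0) (fun s h h' => ?_) hc
    rw [hs s h] at h'
    simp at h'
    omega
  by_cases hi : i = -1
  · subst hi
    have hr : joinPowerRank 0 (-1) = 1 := by simp [joinPowerRank]
    rw [hr]
    refine ⟨LinearMap.toSpanSingleton ℤ _ (Finsupp.single ∅ 1) ∘ₗ LinearMap.proj 0,
      LinearMap.pi fun _ => Finsupp.lapply ∅, fun a => ?_, fun a => ?_, fun c hc => ?_,
      fun a => ?_, fun c hc h => ⟨0, Submodule.zero_mem _, ?_⟩⟩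
    · exact Submodule.smul_mem _ _ (single_mem_chains (Or.inl rfl) (by simp) _)
    · simp only [LinearMap.comp_apply, LinearMap.toSpanSingleton_apply, map_smul,
        simplexBoundary_empty, smul_zero]
    · rw [h0 _ (by norm_num) c hc]
      simp
    · funext k
      simp [Subsingleton.elim k 0]
    · rw [map_zero, eq_comm, sub_eq_zero]
      exact eq_on_chains (f := LinearMap.id) (g := (LinearMap.toSpanSingleton ℤ _
        (Finsupp.single ∅ 1)) ∘ₗ Finsupp.lapply ∅) (fun s h _ => by simp [hs s h]) hc
  · have hr : joinPowerRank 0 i = 0 := by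
      unfold joinPowerRank
      split_ifs with h
      · apply Nat.choose_eq_zero_of_lt
        push_cast at h ⊢
        omega
      · rfl
    rw [hr]
    exact ⟨0, 0, fun a => Submodule.zero_mem _, fun a => by simp, fun c hc => rfl,
      fun a => Subsingleton.elim _ _, fun c hc h => ⟨0, Submodule.zero_mem _, by
        simp [h0 i hi c hc]⟩⟩

/-- The model for the homology of the join of `n` copies of the disjoint union of a square and a
point. -/
theorem nonempty_joinPowerModel (n : ℕ) : ∀ i : ℤ, Nonempty
    (HomologyModel (squareAndPoint.joinPower n) i (Fin (joinPowerRank n i) → ℤ)) := by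
  induction n with
  | zero => exact fun i => ⟨botHomologyModel i⟩
  | succ n ih =>
    intro i
    -- The cycles of degrees 0 and 1 call for the models in degrees `i - 1` and `i - 2`, so the
    -- induction hypothesis must cover all degrees.
    let S := squareAndPointSplitting
    have D := S.joinModel i fun k => (ih (i - S.degree k - 1)).some
    let e : (∀ k : Fin 2, Fin (joinPowerRank n (i - S.degree k - 1)) → ℤ) ≃ₗ[ℤ]
        (Fin (joinPowerRank (n + 1) i) → ℤ) :=
      -- The two coordinate vectors are concatenated; the lengths agree by Pascal's rule.
      (LinearEquiv.piCurry ℤ fun _ _ => ℤ).symm ≪≫ₗ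
        LinearEquiv.funCongrLeft ℤ ℤ ((finCongr (by
          rw [Fin.sum_univ_two, joinPowerRank_succ]
          change _ = joinPowerRank n (i - 0 - 1) + joinPowerRank n (i - 1 - 1)
          rw [sub_zero, sub_sub i 1 1]
          rfl)).trans finSigmaFinEquiv.symm)
    exact ⟨D.congr e⟩

end PreAbstractSimplicialComplex

theorem proposition6p1 (n : ℕ) (i : ℤ) :
    (((n : ℤ) - 1 ≤ i ∧ i ≤ 2 * (n : ℤ) - 1) →
      Nonempty ((squareAndPoint.joinPower n).reducedHomology i ≃ₗ[ℤ]
        (Fin (n.choose (i - (n : ℤ) + 1).toNat) → ℤ))) ∧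
    (¬ ((n : ℤ) - 1 ≤ i ∧ i ≤ 2 * (n : ℤ) - 1) →
      Subsingleton ((squareAndPoint.joinPower n).reducedHomology i)) := by
  obtain ⟨D⟩ := PreAbstractSimplicialComplex.nonempty_joinPowerModel n i
  obtain ⟨e⟩ := D.nonempty_equiv
  refine ⟨fun h => ?_, fun h => ?_⟩
  · rw [PreAbstractSimplicialComplex.joinPowerRank, if_pos h.1] at e
    exact ⟨e⟩
  · have hr : PreAbstractSimplicialComplex.joinPowerRank n i = 0 := by
      unfold PreAbstractSimplicialComplex.joinPowerRank
      split_ifs with h'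
      -- Here the lower bound holds, so the upper one fails and the lower index exceeds `n`.
      · exact Nat.choose_eq_zero_of_lt (by omega)
      · rfl
    rw [hr] at e
    exact e.toEquiv.subsingleton
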